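/- **Action theories.** Fix a set $\mathbf F$ of fluents and a set $\mathbf A$ of actions. A literal is $f$ or $\neg f$ with $f\in\mathbf F$; $\neg l$ denotes the complement of a literal $l$, and $\neg\sigma=\{\neg l\mid l\in\sigma\}$. A set of literals is *consistent* if it contains no two complementary literals. A *domain description* $\mathcal D$ is a set of propositions $\mathbf{executable}(a,\psi)$, $\mathbf{causes}(a,l,\phi)$, $\mathbf{if}(l,\varphi)$ and $\mathbf{determines}(a,\theta)$, where $a\in\mathbf A$, $l$ is a literal and $\psi,\phi,\varphi,\theta$ are sets of literals (read as conjunctions). $a$ is a *sensing action* if some $\mathbf{determines}(a,\theta)$ is in $\mathcal D$, and *non-sensing* otherwise. We assume: no sensing action occurs in a proposition $\mathbf{causes}(a,l,\phi)$; each sensing action occurs in just one proposition $\mathbf{determines}(a,\theta)$; each such $\theta$ has at least two elements and either is $\{f,\neg f\}$ for a fluent $f$, or $\mathcal D$ contains $\mathbf{if}(\neg g',\{g\})$ for all distinct $g,g'\in\theta$ and $\mathbf{if}(g,\{\neg g'\mid g'\in\theta\setminus\{g\}\})$ for all $g\in\theta$; and $\varphi\neq\emptyset$ for each $\mathbf{if}(l,\varphi)\in\mathcal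 D$. A *planning problem* is $\mathcal P=(\mathcal D,\mathcal I,\mathcal G)$, where $\mathcal I$ is a set of propositions $\mathbf{initially}(l)$ and $\mathcal G$ is a non-empty set of literals (read as a conjunction). $Cl_{\mathcal D}(\sigma)$ is the least set of literals that includes $\sigma$ and contains $l$ whenever $\mathbf{if}(l,\varphi)\in\mathcal D$ and it includes $\varphi$; sets with the latter property are *closed*. A *state* is a closed consistent set of literals that contains $f$ or $\neg f$ for each $f\in\mathbf F$; an *a-state* is a closed consistent set of literals, *valid* if it is included in a state. $a$ is *executable* in $\sigma$ if $\psi\subseteq\sigma$ for some $\mathbf{executable}(a,\psi)\in\mathcal D$. Put $E(a,\sigma)=\{l\mid \mathbf{causes}(a,l,\phi)\in\mathcal D,\ \phi\subseteq\sigma\}$. $\mathcal D$ is *consistent* if for every state $s$ and every non-sensing action $a$ executable in $s$ there is a state $s'$ with $s'=Cl_{\mathcal D}(E(a,s)\cup(s\cap s'))$. $(\mathcal D,\mathcal I)$ is *consistent* if $\mathcal D$ is consistent and the *initial a-state* $\delta_0=Cl_{\mathcal D}(\{l\mid\mathbf{initially}(l)\in\mathcal I\})$ is a valid a-state. **The 0-approximation.**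 For a non-sensing action $a$ put $e(a,\delta)=Cl_{\mathcal D}(E(a,\delta))$ and $pc(a,\delta)=\bigcup_i pc^i(a,\delta)$, where $pc^0(a,\delta)=\{l\mid \mathbf{causes}(a,l,\phi)\in\mathcal D,\ l\notin\delta,\ \neg\phi\cap\delta=\emptyset\}$ and $pc^{i+1}(a,\delta)=pc^i(a,\delta)\cup\{l\mid \mathbf{if}(l,\varphi)\in\mathcal D,\ l\notin\delta,\ \varphi\cap pc^i(a,\delta)\ne\emptyset,\ \neg\varphi\cap e(a,\delta)=\emptyset\}$. $Res(a,\delta)$ is the set whose only element is $\delta'=Cl_{\mathcal D}(e(a,\delta)\cup(\delta\setminus\neg pc(a,\delta)))$ if $\delta'$ is consistent, and $\emptyset$ otherwise. For a sensing action $a$ with $\mathbf{determines}(a,\theta)\in\mathcal D$, $Res(a,\delta)$ is the set of the consistent ones among the sets $Cl_{\mathcal D}(\delta\cup\{g\})$, $g\in\theta$. $\Phi(a,\delta)=Res(a,\delta)$ if $a$ is executable in $\delta$, and $\Phi(a,\delta)=\bot$ otherwise. *Conditional plans* are $[]$; $[a;p]$ with $a$ non-sensing and $p$ a conditional plan; and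 $[a;\mathbf{cases}(\{g\to p_g\}_{g\in\theta})]$ with $\mathbf{determines}(a,\theta)\in\mathcal D$ and conditional plans $p_g$. Put $\hat\Phi([],\delta)=\{\delta\}$; for the other two forms $\hat\Phi(p,\delta)=\bot$ if $\Phi(a,\delta)=\bot$, and otherwise $\hat\Phi([a;q],\delta)=\bigcup_{\delta'\in\Phi(a,\delta)}\hat\Phi(q,\delta')$ and $\hat\Phi([a;\mathbf{cases}(\{g\to p_g\}_{g\in\theta})],\delta)=\bigcup\{\hat\Phi(p_g,\delta')\mid g\in\theta,\ \delta'\in\Phi(a,\delta),\ g\in\delta'\}$, where a union with a member $\bot$ is $\bot$. A conditional plan $p$ is a *solution* to $\mathcal P$ if $\hat\Phi(p,\delta_0)\ne\bot$ and $\mathcal G\subseteq\delta$ for every $\delta\in\hat\Phi(p,\delta_0)$. **The program.** For $h,w\ge1$, $\pi_{h,w}(\mathcal P)$ consists of the ground instances of the rules below, with $T\in\{1,\dots,h\}$, $T_1\in\{1,\dots,h+1\}$, $P,P_1,P_2\in\{1,\dots,w\}$, $F$ a fluent, $L,L_1$ literals, $A$ an action, and $G,G_1,G_2$ sensed literals (members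 of some $\theta$ with $\mathbf{determines}(a,\theta)\in\mathcal D$); comparisons are conditions on the instances. For a set $\gamma$, $p(\gamma,\dots)$ in a body stands for all $p(x,\dots)$, $x\in\gamma$, and $\mathit{not}\ p(\gamma,\dots)$ for all $\mathit{not}\ p(x,\dots)$, $x\in\gamma$. - Facts: $time(T)$; $time1(T_1)$; $path(P)$; $action(A)$; $fluent(F)$; $sense(G)$; $literal(F)$; $literal(\neg F)$; $contrary(F,\neg F)$; $contrary(\neg F,F)$; $new\_br(P,P_1)$ if $P\le P_1$; $used(1,1)$; $holds(l,1,1)$ for $\mathbf{initially}(l)\in\mathcal I$. - For $\mathbf{executable}(a,\psi)\in\mathcal D$: $poss(a,T,P)\leftarrow holds(\psi,T,P)$. - For $\mathbf{causes}(a,l,\phi)\in\mathcal D$: $e(l,T,P)\leftarrow occ(a,T,P),holds(\phi,T,P)$; $\ pc(l,T,P)\leftarrow occ(a,T,P),\mathit{not}\ holds(l,T,P),\mathit{not}\ holds(\neg\phi,T,P)$. - For $\mathbf{determines}(a,\theta)\in\mathcal D$: $\leftarrow occ(a,T,P),\mathit{not}\ br(\theta,T,P,P)$; and for each $g\in\theta$: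 $\ 1\{br(g,T,P,X)\mid P\le X\le w\}1\leftarrow occ(a,T,P)$; $\ \leftarrow occ(a,T,P),holds(g,T,P)$. - For $\mathbf{if}(l,\varphi)\in\mathcal D$: $pc(l,T,P)\leftarrow \mathit{not}\ holds(l,T,P),pc(l',T,P),\mathit{not}\ e(\neg\varphi,T,P)$ for each $l'\in\varphi$; $\ e(l,T,P)\leftarrow e(\varphi,T,P)$; $\ holds(l,T_1,P)\leftarrow holds(\varphi,T_1,P)$. - $goal(T_1,P)\leftarrow holds(\mathcal G,T_1,P)$; $\ goal(T_1,P)\leftarrow holds(L,T_1,P),holds(L_1,T_1,P),contrary(L,L_1)$; $\ \leftarrow used(h{+}1,P),\mathit{not}\ goal(h{+}1,P)$. - $holds(L,T{+}1,P)\leftarrow e(L,T,P)$; $\ holds(L,T{+}1,P)\leftarrow holds(L,T,P),contrary(L,L_1),\mathit{not}\ pc(L_1,T,P)$. - $\leftarrow br(G_1,T,P_1,P),br(G_2,T,P_2,P)$ if $P_1<P_2<P$; $\ \leftarrow br(G_1,T,P_1,P),br(G_2,T,P_1,P)$ if $P_1\le P$, $G_1\ne G_2$; $\ \leftarrow br(G,T,P_1,P),used(T,P)$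 if $P_1<P$. - $used(T{+}1,P)\leftarrow br(G,T,P_1,P)$ if $P_1<P$; $\ holds(G,T{+}1,P)\leftarrow br(G,T,P_1,P)$ if $P_1\le P$; $\ holds(L,T{+}1,P)\leftarrow br(G,T,P_1,P),holds(L,T,P_1)$ if $P_1<P$. - $1\{occ(a,T,P)\mid a\in\mathbf A\}1\leftarrow used(T,P),\mathit{not}\ goal(T,P)$; $\ \leftarrow occ(A,T,P),\mathit{not}\ poss(A,T,P)$; $\ used(T{+}1,P)\leftarrow used(T,P)$. A set $S$ of atoms is an *answer set* of the program if $S$ satisfies all its rules (a head $1\{B\}1$ is satisfied if $|B\cap S|=1$, an empty head never) and $S$ is the least set of atoms closed under the reduct with respect to $S$, that is, under the rules $x\leftarrow body^+$ obtained from the rules whose body has no $\mathit{not}\ y$ with $y\in S$, where $body^+$ is the set of positive body atoms and $x$ is the head atom, or any member of $B\cap S$ if the head is $1\{B\}1$. **Extraction.** For an answer set $S$, $1\le i\le h+1$ and $1\le k\le w$, the plan $p_i^k(S)$ is $[]$ if $i=h+1$ or $occ(a,i,k)\notin S$ for all $a$; it is $[a;p_{i+1}^k(S)]$ if $i\le h$,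 $occ(a,i,k)\in S$ and $a$ is non-sensing; and it is $[a;\mathbf{cases}(\{g\to p_{i+1}^{k_g}(S)\}_{g\in\theta})]$ if $i\le h$, $occ(a,i,k)\in S$, $\mathbf{determines}(a,\theta)\in\mathcal D$ and $br(g,i,k,k_g)\in S$ for all $g\in\theta$. **Theorem 3.1.** Let $(\mathcal D,\mathcal I)$ be a consistent action theory, $\mathcal P=(\mathcal D,\mathcal I,\mathcal G)$ a planning problem, and $h,w\ge1$ integers. If $S$ is an answer set of $\pi_{h,w}(\mathcal P)$, then the extraction returns exactly one plan $p_1^1(S)$, and $p_1^1(S)$ is a conditional plan that is a solution to $\mathcal P$. -/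

import Mathlib

namespace ASCP

/-! ### Action theories -/

/-- A fluent literal over the fluents `F`: a fluent `f` or its negation. -/
inductive Lit (F : Type*) where
  | pos (f : F) : Lit F
  | neg (f : F) : Lit F

/-- The complement of a literal. -/
def Lit.compl {F : Type*} : Lit F → Lit F
  | .pos f => .neg f
  | .neg f => .pos f

/-- The propositions a domain description consists of. A set of literals in a proposition is read as
the conjunction of its members. -/
inductive Proposition (F A : Type*) where
  /-- `a` is executable in any situation in which `ψ` holds -/
  | executable (a : A) (ψ : Set (Lit F)) : Proposition F A
  /-- dynamic causal law: performing `a` where `φ` holds causes `l` -/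
  | causes (a : A) (l : Lit F) (φ : Set (Lit F)) : Proposition F A
  /-- static causal law `if(l, φ)`: `l` holds in any situation in which `φ` holds -/
  | staticLaw (l : Lit F) (φ : Set (Lit F)) : Proposition F A
  /-- knowledge proposition: the values of the literals in `θ` are known after `a` -/
  | determines (a : A) (θ : Set (Lit F)) : Proposition F A

/-- A domain description is a set of propositions. -/
abbrev Domain (F A : Type*) := Set (Proposition F A)

section Semantics

variable {F A : Type*}

/-- A sensing action is one that occurs in a knowledge proposition; the others are non-sensing. -/
def Sensing (D : Domain F A) (a : A) : Prop :=
  ∃ θ, Proposition.determines a θ ∈ D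

/-- `D` contains `oneof(θ)`: the literals of `θ` are mutually exclusive, and each one follows from
the negations of all the others. -/
def ContainsOneof (D : Domain F A) (θ : Set (Lit F)) : Prop :=
  (∀ g ∈ θ, ∀ g' ∈ θ, g ≠ g' → Proposition.staticLaw g'.compl {g} ∈ D) ∧
  (∀ g ∈ θ, Proposition.staticLaw g (Lit.compl '' (θ \ {g})) ∈ D)

/-- The syntactic conventions on domain descriptions. -/
structure WellFormed (D : Domain F A) : Prop where
  /-- sensing actions do not occur in dynamic causal laws -/
  disjoint : ∀ a l φ, Proposition.causes a l φ ∈ D → ¬ Sensing D a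
  /-- each sensing action occurs in just one knowledge proposition -/
  determines_unique : ∀ a θ θ', Proposition.determines a θ ∈ D →
    Proposition.determines a θ' ∈ D → θ = θ'
  /-- at least two literals are sensed -/
  determines_nontrivial : ∀ a θ, Proposition.determines a θ ∈ D → θ.Nontrivial
  /-- the sensed literals are a complementary pair, or `oneof` of them is in `D` -/
  determines_oneof : ∀ a θ, Proposition.determines a θ ∈ D →
    (∃ f, θ = {Lit.pos f, Lit.neg f}) ∨ ContainsOneof D θ
  /-- no static causal law has an empty body -/
  static_nonempty : ∀ l φ, Proposition.staticLaw l φ ∈ D → φ.Nonempty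

/-- A set of literals is consistent if it does not contain two complementary literals. -/
def Consistent (σ : Set (Lit F)) : Prop :=
  ∀ l ∈ σ, l.compl ∉ σ

/-- `γ` possibly holds in `σ`: no complement of a member of `γ` is in `σ`.
(`γ` holds in `σ` is just `γ ⊆ σ`.) -/
def PossiblyHolds (γ σ : Set (Lit F)) : Prop :=
  (Lit.compl '' γ) ∩ σ = ∅

/-- `σ` satisfies all static causal laws of `D`. -/
def SatisfiesStatic (D : Domain F A) (σ : Set (Lit F)) : Prop :=
  ∀ l φ, Proposition.staticLaw l φ ∈ D → φ ⊆ σ → l ∈ σ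

/-- The smallest set of literals that includes `σ` and satisfies all static causal laws. -/
def Cl (D : Domain F A) (σ : Set (Lit F)) : Set (Lit F) :=
  ⋂₀ {τ | σ ⊆ τ ∧ SatisfiesStatic D τ}

/-- A state: a complete and consistent set of literals satisfying all static causal laws. -/
structure IsState (D : Domain F A) (s : Set (Lit F)) : Prop where
  complete : ∀ f, Lit.pos f ∈ s ∨ Lit.neg f ∈ s
  consistent : Consistent s
  satisfies : SatisfiesStatic D s

/-- An action is executable in `σ` if the body of one of its executability conditions holds. -/
def Executable (D : Domain F A) (a : A) (σ : Set (Lit F)) : Prop :=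
  ∃ ψ, Proposition.executable a ψ ∈ D ∧ ψ ⊆ σ

/-- Direct effects of `a` in `σ`. -/
def directEffects (D : Domain F A) (a : A) (σ : Set (Lit F)) : Set (Lit F) :=
  {l | ∃ φ, Proposition.causes a l φ ∈ D ∧ φ ⊆ σ}

/-- Possible next states after a non-sensing action, under complete information. -/
def ResC (D : Domain F A) (a : A) (s : Set (Lit F)) : Set (Set (Lit F)) :=
  {s' | IsState D s' ∧ s' = Cl D (directEffects D a s ∪ (s ∩ s'))}

/-- A domain description is consistent if every non-sensing action that is executable in a state
has a possible next state. -/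
def ConsistentDomain (D : Domain F A) : Prop :=
  ∀ s, IsState D s → ∀ a, ¬ Sensing D a → Executable D a s → (ResC D a s).Nonempty

/-- An a-state is a consistent set of literals satisfying all static causal laws. -/
def IsAState (D : Domain F A) (δ : Set (Lit F)) : Prop :=
  Consistent δ ∧ SatisfiesStatic D δ

/-- An a-state is valid if it is a subset of some state. -/
def IsValid (D : Domain F A) (δ : Set (Lit F)) : Prop :=
  IsAState D δ ∧ ∃ s, IsState D s ∧ δ ⊆ s

/-- The initial a-state, where `I` is the set of the literals `l` with `initially(l)`. -/
def initialAState (D : Domain F A) (I : Set (Lit F)) : Set (Lit F) :=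
  Cl D I

/-- Consistent action theories. -/
def ConsistentTheory (D : Domain F A) (I : Set (Lit F)) : Prop :=
  ConsistentDomain D ∧ IsValid D (initialAState D I)

/-! ### The 0-approximation -/

/-- What definitely holds after the non-sensing action `a`. -/
def eff (D : Domain F A) (a : A) (δ : Set (Lit F)) : Set (Lit F) :=
  Cl D (directEffects D a δ)

/-- The stages of the set of literals that may change. -/
def pcStage (D : Domain F A) (a : A) (δ : Set (Lit F)) : ℕ → Set (Lit F)
  | 0 => {l | ∃ φ, Proposition.causes a l φ ∈ D ∧ l ∉ δ ∧ PossiblyHolds φ δ}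
  | i + 1 => pcStage D a δ i ∪
      {l | ∃ φ, Proposition.staticLaw l φ ∈ D ∧ l ∉ δ ∧ (φ ∩ pcStage D a δ i).Nonempty ∧
        PossiblyHolds φ (eff D a δ)}

/-- What may change when the non-sensing action `a` is performed. -/
def possibleChanges (D : Domain F A) (a : A) (δ : Set (Lit F)) : Set (Lit F) :=
  ⋃ i, pcStage D a δ i

/-- The result function for non-sensing actions: a single a-state, or none. -/
def ResNonSensing (D : Domain F A) (a : A) (δ : Set (Lit F)) : Set (Set (Lit F)) :=
  {δ' | δ' = Cl D (eff D a δ ∪ (δ \ (Lit.compl '' possibleChanges D a δ))) ∧ Consistent δ'}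

/-- The result function for sensing actions: one a-state for each sensed literal that is
consistent with what is known. -/
def ResSensing (D : Domain F A) (a : A) (δ : Set (Lit F)) : Set (Set (Lit F)) :=
  {δ' | ∃ θ, Proposition.determines a θ ∈ D ∧ ∃ g ∈ θ, δ' = Cl D (δ ∪ {g}) ∧ Consistent δ'}

open Classical in
/-- The transition function; `none` stands for `⊥` (the action is not executable). -/
noncomputable def Phi (D : Domain F A) (a : A) (δ : Set (Lit F)) : Option (Set (Set (Lit F))) :=
  if Executable D a δ then
    some (if Sensing D a then ResSensing D a δ else ResNonSensing D a δ)
  else none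

/-- Raw conditional plans: the empty plan, an action followed by a plan, an action followed by a case
distinction with one subplan for each literal in `θ`. -/
inductive Plan (F A : Type*) where
  | empty : Plan F A
  | seq (a : A) (p : Plan F A) : Plan F A
  | cases (a : A) (θ : Set (Lit F)) (p : θ → Plan F A) : Plan F A

/-- The conditional plans of `D`: the actions of `seq` are non-sensing, those of `cases` are sensing
actions and the cases are the literals they sense. -/
def IsConditionalPlan (D : Domain F A) : Plan F A → Prop
  | .empty => True
  | .seq a p => ¬ Sensing D a ∧ IsConditionalPlan D p
  | .cases a θ p => Proposition.determines a θ ∈ D ∧ ∀ g, IsConditionalPlan D (p g)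

open Classical in
/-- The union of the sets `f i`, `i ∈ s`, with the convention that it is `⊥` if one of them is. -/
noncomputable def unionBot {ι β : Type*} (s : Set ι) (f : ι → Option (Set β)) : Option (Set β) :=
  if ∃ i ∈ s, f i = none then none else some {x | ∃ i ∈ s, ∃ Y, f i = some Y ∧ x ∈ Y}

/-- The extended transition function. -/
noncomputable def PhiHat (D : Domain F A) : Plan F A → Set (Lit F) → Option (Set (Set (Lit F)))
  | .empty, δ => some {δ}
  | .seq a q, δ =>
      match Phi D a δ with
      | none => none
      | some X => unionBot X (fun δ' => PhiHat D q δ')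
  | .cases a θ p, δ =>
      match Phi D a δ with
      | none => none
      | some X => unionBot {x : θ × Set (Lit F) | x.2 ∈ X ∧ (x.1 : Lit F) ∈ x.2}
          (fun x => PhiHat D (p x.1) x.2)

/-- `D` entails, from `I`, that the conjunction of the literals in `G` is known after `p`. -/
def EntailsKnowsAfter (D : Domain F A) (I G : Set (Lit F)) (p : Plan F A) : Prop :=
  ∃ X, PhiHat D p (initialAState D I) = some X ∧ ∀ δ ∈ X, G ⊆ δ

/-- `p` is a conditional plan that achieves the goal `G`. -/
def IsSolution (D : Domain F A) (I G : Set (Lit F)) (p : Plan F A) : Prop :=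
  IsConditionalPlan D p ∧ EntailsKnowsAfter D I G p

end Semantics

/-! ### Logic programs with cardinality heads, and their answer sets -/

/-- Heads of ground rules: an atom, the empty head of a constraint, or a cardinality
head `l {s} u`. -/
inductive Head (α : Type*) where
  | atom (x : α) : Head α
  | falsum : Head α
  | card (l : ℕ) (s : Set α) (u : ℕ) : Head α

/-- A ground rule: its head, the atoms `x` of its body, and the atoms `x` with `not x` in its
body. -/
structure Rule (α : Type*) where
  head : Head α
  pos : Set α
  neg : Set α

section AnswerSets

variable {α : Type*}

/-- Satisfaction of a head by a set of atoms. -/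
def Head.Holds (S : Set α) : Head α → Prop
  | .atom x => x ∈ S
  | .falsum => False
  | .card l s u => (l : ℕ∞) ≤ (s ∩ S).encard ∧ (s ∩ S).encard ≤ (u : ℕ∞)

/-- Satisfaction of a rule by a set of atoms. -/
def Rule.Holds (S : Set α) (r : Rule α) : Prop :=
  r.pos ⊆ S → Disjoint r.neg S → r.head.Holds S

/-- The atoms that head a rule in the reduct with respect to `S`: from a cardinality head, those of
its atoms that are in `S`. -/
def Head.reduct (S : Set α) : Head α → Set α
  | .atom x => {x}
  | .falsum => ∅
  | .card _ s _ => s ∩ S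

/-- `X` is closed under the reduct of `Q` with respect to `S`, which consists of the
rules `x ← r.pos`, for the rules `r` of `Q` with no `not y`, `y ∈ S`, in the body
and `x ∈ r.head.reduct S`. -/
def ClosedUnderReduct (Q : Set (Rule α)) (S X : Set α) : Prop :=
  ∀ r ∈ Q, Disjoint r.neg S → r.pos ⊆ X → r.head.reduct S ⊆ X

/-- Answer sets (stable models): `S` satisfies all rules and is the least set of atoms that is closed
under the reduct with respect to `S`. -/
def IsAnswerSet (Q : Set (Rule α)) (S : Set α) : Prop :=
  (∀ r ∈ Q, r.Holds S) ∧ IsLeast {X | ClosedUnderReduct Q S X} S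

/-- `x ←` -/
def fact (x : α) : Rule α := ⟨.atom x, ∅, ∅⟩

/-- `x ← pos, not neg` -/
def normal (x : α) (pos neg : Set α) : Rule α := ⟨.atom x, pos, neg⟩

/-- `← pos, not neg` -/
def constraint (pos neg : Set α) : Rule α := ⟨.falsum, pos, neg⟩

/-- `1 {s} 1 ← pos, not neg` -/
def exactlyOne (s : Set α) (pos neg : Set α) : Rule α := ⟨.card 1 s 1, pos, neg⟩

end AnswerSets

/-! ### The encoding -/

/-- The ground atoms of the encoding. -/
inductive Atom (F A : Type*) where
  | time (t : ℕ) : Atom F A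
  | time1 (t : ℕ) : Atom F A
  | path (p : ℕ) : Atom F A
  | action (a : A) : Atom F A
  | fluent (f : F) : Atom F A
  | sense (g : Lit F) : Atom F A
  | literal (l : Lit F) : Atom F A
  | contrary (l l₁ : Lit F) : Atom F A
  | holds (l : Lit F) (t p : ℕ) : Atom F A
  | poss (a : A) (t p : ℕ) : Atom F A
  | occ (a : A) (t p : ℕ) : Atom F A
  | e (l : Lit F) (t p : ℕ) : Atom F A
  | pc (l : Lit F) (t p : ℕ) : Atom F A
  | goal (t p : ℕ) : Atom F A
  | br (g : Lit F) (t p p₁ : ℕ) : Atom F A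
  | used (t p : ℕ) : Atom F A
  | newBr (p p₁ : ℕ) : Atom F A

section Encoding

variable {F A : Type*}

/-- `g` is a sensed literal of `D`. -/
def SensedLit (D : Domain F A) (g : Lit F) : Prop :=
  ∃ a θ, Proposition.determines a θ ∈ D ∧ g ∈ θ

open Atom Proposition Set in
/-- The ground rules of the encoding of the problem `(D, I, G)` with `h` rows and `w` columns. Every
variable ranges over its sort: `t ∈ Icc 1 h` for times, `t ∈ Icc 1 (h + 1)` for extended times,
`p, p₁, p₂ ∈ Icc 1 w` for paths, sensed literals for `g, g₁, g₂`. Arithmetic comparisons and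
the conditions in cardinality heads are evaluated in the ground instances. -/
inductive EncodingRule (D : Domain F A) (I G : Set (Lit F)) (h w : ℕ) :
    Rule (Atom F A) → Prop
  -- facts for the sorts
  | time (t : ℕ) : t ∈ Icc 1 h → EncodingRule D I G h w (fact (time t))
  | time1 (t : ℕ) : t ∈ Icc 1 (h + 1) → EncodingRule D I G h w (fact (time1 t))
  | path (p : ℕ) : p ∈ Icc 1 w → EncodingRule D I G h w (fact (path p))
  | action (a : A) : EncodingRule D I G h w (fact (action a))
  | fluent (f : F) : EncodingRule D I G h w (fact (fluent f))
  | sense (g : Lit F) : SensedLit D g → EncodingRule D I G h w (fact (sense g))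
  -- initial situation
  | init (l : Lit F) : l ∈ I → EncodingRule D I G h w (fact (holds l 1 1))
  -- executability conditions
  | poss (a : A) (ψ : Set (Lit F)) (t p : ℕ) : executable a ψ ∈ D → t ∈ Icc 1 h → p ∈ Icc 1 w →
      EncodingRule D I G h w (normal (poss a t p) {x | ∃ l ∈ ψ, x = holds l t p} ∅)
  -- effects of non-sensing actions
  | causes_e (a : A) (l : Lit F) (φ : Set (Lit F)) (t p : ℕ) :
      causes a l φ ∈ D → t ∈ Icc 1 h → p ∈ Icc 1 w →
      EncodingRule D I G h w
        (normal (e l t p) ({occ a t p} ∪ {x | ∃ m ∈ φ, x = holds m t p}) ∅)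
  | causes_pc (a : A) (l : Lit F) (φ : Set (Lit F)) (t p : ℕ) :
      causes a l φ ∈ D → t ∈ Icc 1 h → p ∈ Icc 1 w →
      EncodingRule D I G h w
        (normal (pc l t p) {occ a t p} ({holds l t p} ∪ {x | ∃ m ∈ φ, x = holds m.compl t p}))
  -- effects of sensing actions
  | sense_stay (a : A) (θ : Set (Lit F)) (t p : ℕ) :
      determines a θ ∈ D → t ∈ Icc 1 h → p ∈ Icc 1 w →
      EncodingRule D I G h w (constraint {occ a t p} {x | ∃ g ∈ θ, x = br g t p p})
  | sense_branch (a : A) (θ : Set (Lit F)) (g : Lit F) (t p : ℕ) :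
      determines a θ ∈ D → g ∈ θ → t ∈ Icc 1 h → p ∈ Icc 1 w →
      EncodingRule D I G h w
        (exactlyOne {x | ∃ p₁ ∈ Icc 1 w, p ≤ p₁ ∧ x = br g t p p₁} {occ a t p} ∅)
  | sense_unknown (a : A) (θ : Set (Lit F)) (g : Lit F) (t p : ℕ) :
      determines a θ ∈ D → g ∈ θ → t ∈ Icc 1 h → p ∈ Icc 1 w →
      EncodingRule D I G h w (constraint {occ a t p, holds g t p} ∅)
  -- static causal laws
  | static_pc (l : Lit F) (φ : Set (Lit F)) (l' : Lit F) (t p : ℕ) :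
      staticLaw l φ ∈ D → l' ∈ φ → t ∈ Icc 1 h → p ∈ Icc 1 w →
      EncodingRule D I G h w
        (normal (pc l t p) {pc l' t p} ({holds l t p} ∪ {x | ∃ m ∈ φ, x = e m.compl t p}))
  | static_e (l : Lit F) (φ : Set (Lit F)) (t p : ℕ) :
      staticLaw l φ ∈ D → t ∈ Icc 1 h → p ∈ Icc 1 w →
      EncodingRule D I G h w (normal (e l t p) {x | ∃ m ∈ φ, x = e m t p} ∅)
  | static_holds (l : Lit F) (φ : Set (Lit F)) (t p : ℕ) :
      staticLaw l φ ∈ D → t ∈ Icc 1 (h + 1) → p ∈ Icc 1 w →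
      EncodingRule D I G h w (normal (holds l t p) {x | ∃ m ∈ φ, x = holds m t p} ∅)
  -- goal
  | goal_reached (t p : ℕ) : t ∈ Icc 1 (h + 1) → p ∈ Icc 1 w →
      EncodingRule D I G h w (normal (goal t p) {x | ∃ l ∈ G, x = holds l t p} ∅)
  | goal_inconsistent (l l₁ : Lit F) (t p : ℕ) : t ∈ Icc 1 (h + 1) → p ∈ Icc 1 w →
      EncodingRule D I G h w
        (normal (goal t p) {holds l t p, holds l₁ t p, contrary l l₁} ∅)
  | goal_check (p : ℕ) : p ∈ Icc 1 w →
      EncodingRule D I G h w (constraint {used (h + 1) p} {goal (h + 1) p})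
  -- effect and frame axioms for non-sensing actions
  | effect (l : Lit F) (t p : ℕ) : t ∈ Icc 1 h → p ∈ Icc 1 w →
      EncodingRule D I G h w (normal (holds l (t + 1) p) {e l t p} ∅)
  | inertia (l l₁ : Lit F) (t p : ℕ) : t ∈ Icc 1 h → p ∈ Icc 1 w →
      EncodingRule D I G h w
        (normal (holds l (t + 1) p) {holds l t p, contrary l l₁} {pc l₁ t p})
  -- branching at sensing actions
  | br_source (g₁ g₂ : Lit F) (t p p₁ p₂ : ℕ) : SensedLit D g₁ → SensedLit D g₂ →
      t ∈ Icc 1 h → p ∈ Icc 1 w → p₁ ∈ Icc 1 w → p₂ ∈ Icc 1 w → p₁ < p₂ → p₂ < p →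
      EncodingRule D I G h w (constraint {br g₁ t p₁ p, br g₂ t p₂ p} ∅)
  | br_label (g₁ g₂ : Lit F) (t p p₁ : ℕ) : SensedLit D g₁ → SensedLit D g₂ →
      t ∈ Icc 1 h → p ∈ Icc 1 w → p₁ ∈ Icc 1 w → p₁ ≤ p → g₁ ≠ g₂ →
      EncodingRule D I G h w (constraint {br g₁ t p₁ p, br g₂ t p₁ p} ∅)
  | br_fresh (g : Lit F) (t p p₁ : ℕ) : SensedLit D g →
      t ∈ Icc 1 h → p ∈ Icc 1 w → p₁ ∈ Icc 1 w → p₁ < p →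
      EncodingRule D I G h w (constraint {br g t p₁ p, used t p} ∅)
  | br_used (g : Lit F) (t p p₁ : ℕ) : SensedLit D g →
      t ∈ Icc 1 h → p ∈ Icc 1 w → p₁ ∈ Icc 1 w → p₁ < p →
      EncodingRule D I G h w (normal (used (t + 1) p) {br g t p₁ p} ∅)
  | br_holds (g : Lit F) (t p p₁ : ℕ) : SensedLit D g →
      t ∈ Icc 1 h → p ∈ Icc 1 w → p₁ ∈ Icc 1 w → p₁ ≤ p →
      EncodingRule D I G h w (normal (holds g (t + 1) p) {br g t p₁ p} ∅)
  | br_copy (g l : Lit F) (t p p₁ : ℕ) : SensedLit D g →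
      t ∈ Icc 1 h → p ∈ Icc 1 w → p₁ ∈ Icc 1 w → p₁ < p →
      EncodingRule D I G h w
        (normal (holds l (t + 1) p) {br g t p₁ p, holds l t p₁} ∅)
  -- generation of action occurrences
  | occ_generate (t p : ℕ) : t ∈ Icc 1 h → p ∈ Icc 1 w →
      EncodingRule D I G h w
        (exactlyOne {x | ∃ a, x = occ a t p} {used t p} {goal t p})
  | occ_poss (a : A) (t p : ℕ) : t ∈ Icc 1 h → p ∈ Icc 1 w →
      EncodingRule D I G h w (constraint {occ a t p} {poss a t p})
  -- auxiliary rules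
  | literal_pos (f : F) : EncodingRule D I G h w (fact (literal (.pos f)))
  | literal_neg (f : F) : EncodingRule D I G h w (fact (literal (.neg f)))
  | contrary_pos (f : F) : EncodingRule D I G h w (fact (contrary (.pos f) (.neg f)))
  | contrary_neg (f : F) : EncodingRule D I G h w (fact (contrary (.neg f) (.pos f)))
  | new_branch (p p₁ : ℕ) : p ∈ Icc 1 w → p₁ ∈ Icc 1 w → p ≤ p₁ →
      EncodingRule D I G h w (fact (newBr p p₁))
  | used_root : EncodingRule D I G h w (fact (used 1 1))
  | used_next (t p : ℕ) : t ∈ Icc 1 h → p ∈ Icc 1 w →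
      EncodingRule D I G h w (normal (used (t + 1) p) {used t p} ∅)

/-- The logic program that encodes the planning problem `(D, I, G)` on the `h × w` grid. -/
def encoding (h w : ℕ) (D : Domain F A) (I G : Set (Lit F)) : Set (Rule (Atom F A)) :=
  {r | EncodingRule D I G h w r}

/-- `ExtractedPlan D h S i k p`: the extraction procedure returns the plan `p` from the set of
atoms `S`, started at row `i` and column `k`. -/
inductive ExtractedPlan (D : Domain F A) (h : ℕ) (S : Set (Atom F A)) :
    ℕ → ℕ → Plan F A → Prop
  | finished (i k : ℕ) : (i = h + 1 ∨ ∀ a, Atom.occ a i k ∉ S) →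
      ExtractedPlan D h S i k Plan.empty
  | nonSensing (i k : ℕ) (a : A) (p : Plan F A) : i ≤ h → Atom.occ a i k ∈ S → ¬ Sensing D a →
      ExtractedPlan D h S (i + 1) k p → ExtractedPlan D h S i k (Plan.seq a p)
  | sensing (i k : ℕ) (a : A) (θ : Set (Lit F)) (c : θ → ℕ) (p : θ → Plan F A) :
      i ≤ h → Atom.occ a i k ∈ S → Proposition.determines a θ ∈ D →
      (∀ g : θ, Atom.br (g : Lit F) i k (c g) ∈ S) →
      (∀ g : θ, ExtractedPlan D h S (i + 1) (c g) (p g)) →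
      ExtractedPlan D h S i k (Plan.cases a θ p)

end Encoding

end ASCP

/-!
Read the literals that hold in a cell `(t, p)` of the grid off the answer set as a set `stateAt S t
p`. By minimality of the answer set, `stateAt` is the closure of what the rules other than the
static causal laws put into the cell. At a cell where a non-sensing action occurs, no branch comes
in, so the next cell of the column holds its successor a-state. A branch from column `p` to column
`q ≠ p` enters a column that is still unused, hence empty, so the next cell of `q` holds exactly
what is known in column `p` together with the sensed literal. Thus the extracted plan, followed
through the 0-approximation, visits only a-states of the form `stateAt S t p`; it stops where no
action occurs, and the rule that generates actions, together with the goal check in the last row,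
allows this only where the goal is reached. The other way of deriving `goal`, an inconsistent cell,
is excluded since the transition function discards inconsistent sets and the initial a-state is
consistent.
-/

namespace ASCP

section Literals

variable {F : Type*}

@[simp]
theorem Lit.compl_compl (l : Lit F) : l.compl.compl = l := by
  cases l <;> rfl

theorem Lit.mem_image_compl {l : Lit F} {σ : Set (Lit F)} :
    l ∈ Lit.compl '' σ ↔ l.compl ∈ σ := by
  constructor
  · rintro ⟨m, hm, rfl⟩
    rwa [Lit.compl_compl]
  · exact fun hl => ⟨l.compl, hl, l.compl_compl⟩

theorem possiblyHolds_iff {γ σ : Set (Lit F)} :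
    PossiblyHolds γ σ ↔ ∀ m ∈ γ, m.compl ∉ σ := by
  simp [PossiblyHolds, Set.eq_empty_iff_forall_notMem]

end Literals

section Closure

variable {F A : Type*} {D : Domain F A} {σ τ : Set (Lit F)}

theorem subset_cl : σ ⊆ Cl D σ := fun _ hl _ hτ => hτ.1 hl

theorem satisfiesStatic_cl : SatisfiesStatic D (Cl D σ) := fun l φ hlφ hφ τ hτ =>
  hτ.2 l φ hlφ fun _ hm => hφ hm τ hτ

theorem cl_subset (hσ : σ ⊆ τ) (hτ : SatisfiesStatic D τ) : Cl D σ ⊆ τ := fun _ hl => hl τ ⟨hσ, hτ⟩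

theorem WellFormed.cl_empty (hD : WellFormed D) : Cl D (∅ : Set (Lit F)) = ∅ := by
  refine Set.subset_empty_iff.1 (cl_subset subset_rfl fun l φ hlφ hφ => ?_)
  obtain ⟨m, hm⟩ := hD.static_nonempty l φ hlφ
  exact (hφ hm).elim

theorem WellFormed.eq_of_mem_of_mem (hD : WellFormed D) {a : A} {θ : Set (Lit F)}
    (hθ : Proposition.determines a θ ∈ D) (hs : SatisfiesStatic D σ) (hc : Consistent σ)
    {g g' : Lit F} (hg : g ∈ θ) (hg' : g' ∈ θ) (hgσ : g ∈ σ) (hgσ' : g' ∈ σ) : g = g' := by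
  by_contra hne
  rcases hD.determines_oneof a θ hθ with ⟨f, rfl⟩ | hone
  · rcases hg with rfl | rfl <;> rcases hg' with rfl | rfl
    · exact hne rfl
    · exact hc _ hgσ hgσ'
    · exact hc _ hgσ hgσ'
    · exact hne rfl
  · have hcompl : g'.compl ∈ σ :=
      hs _ _ (hone.1 g hg g' hg' hne) (Set.singleton_subset_iff.2 hgσ)
    exact hc _ hgσ' hcompl

end Closure

section PossibleChanges

variable {F A : Type*} {D : Domain F A} {a : A} {δ X : Set (Lit F)} {l m : Lit F}
  {φ : Set (Lit F)}

theorem mem_possibleChanges_of_causes (hφ : Proposition.causes a l φ ∈ D) (hl : l ∉ δ)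
    (hposs : PossiblyHolds φ δ) : l ∈ possibleChanges D a δ :=
  Set.mem_iUnion.2 ⟨0, φ, hφ, hl, hposs⟩

theorem mem_possibleChanges_of_staticLaw (hφ : Proposition.staticLaw l φ ∈ D) (hl : l ∉ δ)
    (hm : m ∈ φ) (hmpc : m ∈ possibleChanges D a δ) (hposs : PossiblyHolds φ (eff D a δ)) :
    l ∈ possibleChanges D a δ := by
  obtain ⟨i, hi⟩ := Set.mem_iUnion.1 hmpc
  exact Set.mem_iUnion.2 ⟨i + 1, Or.inr ⟨φ, hφ, hl, ⟨m, hm, hi⟩, hposs⟩⟩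

theorem possibleChanges_subset
    (hcauses : ∀ l φ, Proposition.causes a l φ ∈ D → l ∉ δ → PossiblyHolds φ δ → l ∈ X)
    (hstatic : ∀ l φ, Proposition.staticLaw l φ ∈ D → l ∉ δ → PossiblyHolds φ (eff D a δ) →
      ∀ m ∈ φ, m ∈ X → l ∈ X) :
    possibleChanges D a δ ⊆ X := by
  refine Set.iUnion_subset fun i => ?_
  induction i with
  | zero => exact fun l ⟨φ, hφ, hl, hposs⟩ => hcauses l φ hφ hl hposs
  | succ i ih =>
    rintro l (hi | ⟨φ, hφ, hl, ⟨m, hm, hmi⟩, hposs⟩)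
    · exact ih hi
    · exact hstatic l φ hφ hl hposs m hm (ih hmi)

theorem WellFormed.eff_eq_empty (hD : WellFormed D) (ha : Sensing D a) : eff D a δ = ∅ := by
  have hdirect : directEffects D a δ = ∅ :=
    Set.eq_empty_iff_forall_notMem.2 fun l ⟨φ, hφ, _⟩ => hD.disjoint a l φ hφ ha
  rw [eff, hdirect, hD.cl_empty]

theorem WellFormed.possibleChanges_eq_empty (hD : WellFormed D) (ha : Sensing D a) :
    possibleChanges D a δ = ∅ :=
  Set.subset_empty_iff.1 <| possibleChanges_subset
    (fun l φ hφ _ _ => hD.disjoint a l φ hφ ha) (fun _ _ _ _ _ _ _ hm => hm)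

end PossibleChanges

section KnowsAfter

variable {F A : Type*} {D : Domain F A} {G δ : Set (Lit F)} {a : A}

/-- The set that the 0-approximation assigns to `δ` and a non-sensing action `a`: it is the only
candidate for a member of `ResNonSensing D a δ`, and is one if it is consistent. -/
def successor (D : Domain F A) (a : A) (δ : Set (Lit F)) : Set (Lit F) :=
  Cl D (eff D a δ ∪ (δ \ (Lit.compl '' possibleChanges D a δ)))

/-- `G` is known after the plan `p` is executed in `δ`: the entailment `EntailsKnowsAfter` with an
arbitrary set of literals in place of the initial a-state. -/
def KnowsAfter (D : Domain F A) (G : Set (Lit F)) (p : Plan F A) (δ : Set (Lit F)) : Prop :=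
  ∃ X, PhiHat D p δ = some X ∧ ∀ δ' ∈ X, G ⊆ δ'

theorem exists_unionBot_eq_some {ι β : Type*} {s : Set ι} {f : ι → Option (Set β)} {P : β → Prop}
    (hf : ∀ i ∈ s, ∃ X, f i = some X ∧ ∀ x ∈ X, P x) :
    ∃ X, unionBot s f = some X ∧ ∀ x ∈ X, P x := by
  have hbot : ¬ ∃ i ∈ s, f i = none := by
    rintro ⟨i, hi, hnone⟩
    obtain ⟨X, hX, -⟩ := hf i hi
    simp [hnone] at hX
  refine ⟨_, if_neg hbot, ?_⟩
  rintro x ⟨i, hi, Y, hY, hx⟩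
  obtain ⟨X, hX, hP⟩ := hf i hi
  obtain rfl : X = Y := Option.some.inj (hX.symm.trans hY)
  exact hP x hx

theorem knowsAfter_empty (hG : G ⊆ δ) : KnowsAfter D G .empty δ :=
  ⟨{δ}, rfl, fun _ hδ' => hδ' ▸ hG⟩

theorem knowsAfter_seq {p : Plan F A} (hexec : Executable D a δ) (ha : ¬ Sensing D a)
    (hp : Consistent (successor D a δ) → KnowsAfter D G p (successor D a δ)) :
    KnowsAfter D G (.seq a p) δ := by
  have hPhi : Phi D a δ = some (ResNonSensing D a δ) := by simp [Phi, hexec, ha]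
  simp only [KnowsAfter, PhiHat, hPhi]
  apply exists_unionBot_eq_some
  rintro _ ⟨rfl, hc⟩
  exact hp hc

theorem WellFormed.knowsAfter_cases (hD : WellFormed D) {θ : Set (Lit F)} {p : θ → Plan F A}
    (hθ : Proposition.determines a θ ∈ D) (hexec : Executable D a δ)
    (hp : ∀ g : θ, Consistent (Cl D (δ ∪ {↑g})) → KnowsAfter D G (p g) (Cl D (δ ∪ {↑g}))) :
    KnowsAfter D G (.cases a θ p) δ := by
  have hPhi : Phi D a δ = some (ResSensing D a δ) := by
    simp [Phi, hexec, show Sensing D a from ⟨θ, hθ⟩]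
  simp only [KnowsAfter, PhiHat, hPhi]
  apply exists_unionBot_eq_some
  rintro ⟨g, _⟩ ⟨⟨θ', hθ', g', hg', rfl, hc⟩, hg⟩
  obtain rfl := hD.determines_unique a θ θ' hθ hθ'
  obtain rfl : (g : Lit F) = g' := hD.eq_of_mem_of_mem hθ satisfiesStatic_cl hc g.2 hg' hg
    (subset_cl (Or.inr rfl))
  exact hp g hc

end KnowsAfter

section AnswerSets

variable {α : Type*} {Q : Set (Rule α)} {S P N B : Set α} {x : α}

@[simp]
theorem reduct_fact : (fact x).head.reduct S = {x} := rfl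

@[simp]
theorem reduct_normal : (normal x P N).head.reduct S = {x} := rfl

@[simp]
theorem reduct_constraint : (constraint P N).head.reduct S = ∅ := rfl

@[simp]
theorem reduct_exactlyOne : (exactlyOne B P N).head.reduct S = B ∩ S := rfl

theorem setOf_exists_eq_subset {ι : Type*} {s : Set ι} {f : ι → α} :
    {x | ∃ i ∈ s, x = f i} ⊆ S ↔ ∀ i ∈ s, f i ∈ S :=
  ⟨fun hs i hi => hs ⟨i, hi, rfl⟩, by rintro hs _ ⟨i, hi, rfl⟩; exact hs i hi⟩

theorem disjoint_setOf_exists_eq {ι : Type*} {s : Set ι} {f : ι → α} :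
    Disjoint {x | ∃ i ∈ s, x = f i} S ↔ ∀ i ∈ s, f i ∉ S :=
  Set.disjoint_left.trans setOf_exists_eq_subset

theorem IsAnswerSet.mem_of_fact (hS : IsAnswerSet Q S) (hr : fact x ∈ Q) : x ∈ S :=
  hS.1 _ hr (Set.empty_subset S) (Set.empty_disjoint S)

theorem IsAnswerSet.mem_of_normal (hS : IsAnswerSet Q S) (hr : normal x P N ∈ Q) (hP : P ⊆ S)
    (hN : Disjoint N S) : x ∈ S :=
  hS.1 _ hr hP hN

theorem IsAnswerSet.not_disjoint_of_constraint (hS : IsAnswerSet Q S) (hr : constraint P N ∈ Q)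
    (hP : P ⊆ S) : ¬ Disjoint N S :=
  hS.1 _ hr hP

theorem IsAnswerSet.existsUnique_of_exactlyOne (hS : IsAnswerSet Q S)
    (hr : exactlyOne B P N ∈ Q) (hP : P ⊆ S) (hN : Disjoint N S) : ∃! x, x ∈ B ∩ S := by
  obtain ⟨hlower, hupper⟩ := hS.1 _ hr hP hN
  rw [Nat.cast_one] at hlower hupper
  obtain ⟨x, hx⟩ := Set.one_le_encard_iff_nonempty.1 hlower
  exact ⟨x, hx, fun y hy => Set.encard_le_one_iff.1 hupper y x hy hx⟩

theorem IsAnswerSet.induction (hS : IsAnswerSet Q S) {ι : Type*} (f : ι → α) {M : ι → Prop}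
    (hM : ∀ r ∈ Q, Disjoint r.neg S → r.pos ⊆ S → (∀ i, f i ∈ r.pos → M i) →
      ∀ i, f i ∈ r.head.reduct S → M i) {i : ι} (hi : f i ∈ S) : M i := by
  have hclosed : ClosedUnderReduct Q S {x | x ∈ S ∧ ∀ i, f i = x → M i} := by
    intro r hr hneg hpos x hx
    refine ⟨hS.2.1 r hr hneg (fun y hy => (hpos hy).1) hx, ?_⟩
    rintro i rfl
    exact hM r hr hneg (fun y hy => (hpos hy).1) (fun j hj => (hpos hj).2 j rfl) i hx
  exact (hS.2.2 hclosed hi).2 i rfl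

theorem IsAnswerSet.exists_rule (hS : IsAnswerSet Q S) (hx : x ∈ S) :
    ∃ r ∈ Q, Disjoint r.neg S ∧ r.pos ⊆ S ∧ x ∈ r.head.reduct S :=
  hS.induction id (M := fun x => ∃ r ∈ Q, Disjoint r.neg S ∧ r.pos ⊆ S ∧ x ∈ r.head.reduct S)
    (fun r hr hneg hpos _ _ hx => ⟨r, hr, hneg, hpos, hx⟩) hx

end AnswerSets

section Encoding

open Atom Proposition Set

variable {F A : Type*} {D : Domain F A} {I G : Set (Lit F)} {h w : ℕ} {S : Set (Atom F A)}
  {a b : A} {θ : Set (Lit F)} {g g' l l₁ : Lit F} {t p p' q : ℕ}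

theorem contrary_mem_iff (hS : IsAnswerSet (encoding h w D I G) S) :
    contrary l l₁ ∈ S ↔ l₁ = l.compl := by
  constructor
  · intro hx
    obtain ⟨r, hr, -, -, hx⟩ := hS.exists_rule hx
    cases hr with
    | contrary_pos f => obtain ⟨⟩ := hx; rfl
    | contrary_neg f => obtain ⟨⟩ := hx; rfl
    | _ => simp at hx
  · rintro rfl
    cases l with
    | pos f => exact hS.mem_of_fact (.contrary_pos f)
    | neg f => exact hS.mem_of_fact (.contrary_neg f)

theorem used_one_one_mem (hS : IsAnswerSet (encoding h w D I G) S) : used 1 1 ∈ S :=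
  hS.mem_of_fact .used_root

theorem used_succ_of_used (hS : IsAnswerSet (encoding h w D I G) S) (ht : t ∈ Icc 1 h)
    (hp : p ∈ Icc 1 w) (hu : used t p ∈ S) : used (t + 1) p ∈ S :=
  hS.mem_of_normal (.used_next t p ht hp) (singleton_subset_iff.2 hu) (empty_disjoint S)

theorem goal_last_mem (hS : IsAnswerSet (encoding h w D I G) S) (hp : p ∈ Icc 1 w)
    (hu : used (h + 1) p ∈ S) : goal (h + 1) p ∈ S := by
  simpa using hS.not_disjoint_of_constraint (.goal_check p hp) (singleton_subset_iff.2 hu)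

theorem occ_mem_imp (hS : IsAnswerSet (encoding h w D I G) S) (ha : occ a t p ∈ S) :
    t ∈ Icc 1 h ∧ p ∈ Icc 1 w ∧ used t p ∈ S ∧ goal t p ∉ S := by
  obtain ⟨r, hr, hneg, hpos, hx⟩ := hS.exists_rule ha
  cases hr with
  | occ_generate t p ht hp =>
    obtain ⟨⟨b, ⟨⟩⟩, -⟩ := hx
    exact ⟨ht, hp, singleton_subset_iff.1 hpos, disjoint_singleton_left.1 hneg⟩
  | _ => simp at hx

theorem existsUnique_occ (hS : IsAnswerSet (encoding h w D I G) S) (ht : t ∈ Icc 1 h)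
    (hp : p ∈ Icc 1 w) (hu : used t p ∈ S) (hg : goal t p ∉ S) : ∃! a, occ a t p ∈ S := by
  obtain ⟨_, ⟨⟨a, rfl⟩, ha⟩, hunique⟩ := hS.existsUnique_of_exactlyOne (.occ_generate t p ht hp)
    (singleton_subset_iff.2 hu) (disjoint_singleton_left.2 hg)
  exact ⟨a, ha, fun b hb => by simpa using hunique _ ⟨⟨b, rfl⟩, hb⟩⟩

theorem occ_unique (hS : IsAnswerSet (encoding h w D I G) S) (ha : occ a t p ∈ S)
    (hb : occ b t p ∈ S) : a = b := by
  obtain ⟨ht, hp, hu, hg⟩ := occ_mem_imp hS ha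
  exact (existsUnique_occ hS ht hp hu hg).unique ha hb

theorem exists_occ_and_iff (hS : IsAnswerSet (encoding h w D I G) S) (ha : occ a t p ∈ S)
    {M : A → Prop} : (∃ b, occ b t p ∈ S ∧ M b) ↔ M a := by
  constructor
  · rintro ⟨b, hb, hM⟩
    rwa [occ_unique hS ha hb]
  · exact fun hM => ⟨a, ha, hM⟩

theorem br_mem_imp (hS : IsAnswerSet (encoding h w D I G) S) (hg : br g t p q ∈ S) :
    q ∈ Icc 1 w ∧ p ≤ q ∧ ∃ a θ, determines a θ ∈ D ∧ g ∈ θ ∧ occ a t p ∈ S := by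
  obtain ⟨r, hr, -, hpos, hx⟩ := hS.exists_rule hg
  cases hr with
  | sense_branch a θ g t p hθ hgθ ht hp =>
    obtain ⟨⟨q, hq, hpq, ⟨⟩⟩, -⟩ := hx
    exact ⟨hq, hpq, a, θ, hθ, hgθ, singleton_subset_iff.1 hpos⟩
  | _ => simp at hx

theorem sensedLit_of_br_mem (hS : IsAnswerSet (encoding h w D I G) S) (hg : br g t p q ∈ S) :
    SensedLit D g := by
  obtain ⟨-, -, a, θ, hθ, hgθ, -⟩ := br_mem_imp hS hg
  exact ⟨a, θ, hθ, hgθ⟩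

theorem source_mem_of_br_mem (hS : IsAnswerSet (encoding h w D I G) S) (hg : br g t p q ∈ S) :
    t ∈ Icc 1 h ∧ p ∈ Icc 1 w ∧ used t p ∈ S := by
  obtain ⟨-, -, a, -, -, -, ha⟩ := br_mem_imp hS hg
  obtain ⟨ht, hp, hu, -⟩ := occ_mem_imp hS ha
  exact ⟨ht, hp, hu⟩

theorem existsUnique_br (hS : IsAnswerSet (encoding h w D I G) S) (hθ : determines a θ ∈ D)
    (hg : g ∈ θ) (ha : occ a t p ∈ S) : ∃! q, br g t p q ∈ S := by
  obtain ⟨ht, hp, -, -⟩ := occ_mem_imp hS ha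
  obtain ⟨_, ⟨⟨q, -, -, rfl⟩, hq⟩, hunique⟩ := hS.existsUnique_of_exactlyOne
    (.sense_branch a θ g t p hθ hg ht hp) (singleton_subset_iff.2 ha) (empty_disjoint S)
  refine ⟨q, hq, fun q' hq' => ?_⟩
  obtain ⟨hq'w, hpq', -⟩ := br_mem_imp hS hq'
  simpa using hunique _ ⟨⟨q', hq'w, hpq', rfl⟩, hq'⟩

theorem used_succ_of_br_mem (hS : IsAnswerSet (encoding h w D I G) S) (hg : br g t p q ∈ S) :
    used (t + 1) q ∈ S := by
  obtain ⟨hq, hpq, -⟩ := br_mem_imp hS hg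
  obtain ⟨ht, hp, hu⟩ := source_mem_of_br_mem hS hg
  rcases hpq.eq_or_lt with rfl | hlt
  · exact used_succ_of_used hS ht hp hu
  · exact hS.mem_of_normal (.br_used g t q p (sensedLit_of_br_mem hS hg) ht hq hp hlt)
      (singleton_subset_iff.2 hg) (empty_disjoint S)

theorem source_eq_of_used (hS : IsAnswerSet (encoding h w D I G) S) (hg : br g t p q ∈ S)
    (hu : used t q ∈ S) : p = q := by
  obtain ⟨hq, hpq, -⟩ := br_mem_imp hS hg
  obtain ⟨ht, hp, -⟩ := source_mem_of_br_mem hS hg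
  by_contra hne
  exact hS.not_disjoint_of_constraint
    (.br_fresh g t q p (sensedLit_of_br_mem hS hg) ht hq hp (hpq.lt_of_ne hne))
    (pair_subset hg hu) (empty_disjoint S)

theorem br_source_unique (hS : IsAnswerSet (encoding h w D I G) S) (hg : br g t p q ∈ S)
    (hg' : br g' t p' q ∈ S) : p = p' := by
  wlog hlt : p < p' generalizing p p' g g'
  · rcases (not_lt.1 hlt).eq_or_lt with heq | hgt
    · exact heq.symm
    · exact (this hg' hg hgt).symm
  obtain ⟨hq, hp'q, -⟩ := br_mem_imp hS hg'
  obtain ⟨ht, hp, -⟩ := source_mem_of_br_mem hS hg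
  obtain ⟨-, hp', hu'⟩ := source_mem_of_br_mem hS hg'
  rcases hp'q.eq_or_lt with rfl | hp'q
  · exact source_eq_of_used hS hg hu'
  · exact (hS.not_disjoint_of_constraint (.br_source g g' t q p p' (sensedLit_of_br_mem hS hg)
      (sensedLit_of_br_mem hS hg') ht hq hp hp' hlt hp'q) (pair_subset hg hg')
      (empty_disjoint S)).elim

theorem br_label_unique (hS : IsAnswerSet (encoding h w D I G) S) (hg : br g t p q ∈ S)
    (hg' : br g' t p q ∈ S) : g = g' := by
  obtain ⟨hq, hpq, -⟩ := br_mem_imp hS hg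
  obtain ⟨ht, hp, -⟩ := source_mem_of_br_mem hS hg
  by_contra hne
  exact hS.not_disjoint_of_constraint (.br_label g g' t q p (sensedLit_of_br_mem hS hg)
    (sensedLit_of_br_mem hS hg') ht hq hp hpq hne) (pair_subset hg hg') (empty_disjoint S)

theorem sensing_of_occ_of_br (hS : IsAnswerSet (encoding h w D I G) S) (ha : occ a t q ∈ S)
    (hg : br g t p q ∈ S) : Sensing D a := by
  obtain rfl := source_eq_of_used hS hg (occ_mem_imp hS ha).2.2.1
  obtain ⟨-, -, b, θ, hθ, -, hb⟩ := br_mem_imp hS hg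
  obtain rfl := occ_unique hS ha hb
  exact ⟨θ, hθ⟩

/-- The literals that hold at row `t` of column `p`, the a-state of a cell of the grid. -/
def stateAt (S : Set (Atom F A)) (t p : ℕ) : Set (Lit F) := {l | holds l t p ∈ S}

theorem executable_of_occ_mem (hS : IsAnswerSet (encoding h w D I G) S) (ha : occ a t p ∈ S) :
    Executable D a (stateAt S t p) := by
  obtain ⟨ht, hp, -, -⟩ := occ_mem_imp hS ha
  have hposs : poss a t p ∈ S := by
    simpa using hS.not_disjoint_of_constraint (.occ_poss a t p ht hp) (singleton_subset_iff.2 ha)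
  obtain ⟨r, hr, -, hpos, hx⟩ := hS.exists_rule hposs
  cases hr with
  | poss a ψ t p hψ =>
    obtain ⟨⟩ := hx
    exact ⟨ψ, hψ, fun l hl => hpos ⟨l, hl, rfl⟩⟩
  | _ => simp at hx

theorem subset_stateAt_of_goal_mem (hS : IsAnswerSet (encoding h w D I G) S)
    (hg : goal t p ∈ S) (hc : Consistent (stateAt S t p)) : G ⊆ stateAt S t p := by
  obtain ⟨r, hr, -, hpos, hx⟩ := hS.exists_rule hg
  cases hr with
  | goal_reached t p =>
    obtain ⟨⟩ := hx
    exact fun l hl => hpos ⟨l, hl, rfl⟩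
  | goal_inconsistent l l₁ t p =>
    obtain ⟨⟩ := hx
    obtain rfl := (contrary_mem_iff hS).1 (hpos (Or.inr (Or.inr rfl)))
    exact (hc l (hpos (Or.inl rfl)) (hpos (Or.inr (Or.inl rfl)))).elim
  | _ => simp at hx

theorem e_mem_iff (hD : WellFormed D) (hS : IsAnswerSet (encoding h w D I G) S) :
    e l t p ∈ S ↔ ∃ a, occ a t p ∈ S ∧ l ∈ eff D a (stateAt S t p) := by
  constructor
  · refine hS.induction (e · t p) (M := fun l => ∃ a, occ a t p ∈ S ∧ l ∈ eff D a (stateAt S t p))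
      fun r hr _ hpos ih l hl => ?_
    cases hr with
    | causes_e a l φ t p hφ =>
      obtain ⟨⟩ := hl
      obtain ⟨ha, hφS⟩ := union_subset_iff.1 hpos
      exact ⟨a, singleton_subset_iff.1 ha, subset_cl ⟨φ, hφ, fun m hm => hφS ⟨m, hm, rfl⟩⟩⟩
    | static_e l φ t p hφ =>
      obtain ⟨⟩ := hl
      obtain ⟨m, hm⟩ := hD.static_nonempty l φ hφ
      obtain ⟨a, ha, -⟩ := ih m ⟨m, hm, rfl⟩
      exact ⟨a, ha, satisfiesStatic_cl l φ hφ fun m hm =>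
        (exists_occ_and_iff hS ha).1 (ih m ⟨m, hm, rfl⟩)⟩
    | _ => simp at hl
  · rintro ⟨a, ha, hl⟩
    obtain ⟨ht, hp, -, -⟩ := occ_mem_imp hS ha
    refine cl_subset (τ := {l | e l t p ∈ S}) ?_ ?_ hl
    · rintro m ⟨φ, hφ, hφδ⟩
      exact hS.mem_of_normal (.causes_e a m φ t p hφ ht hp)
        (union_subset (singleton_subset_iff.2 ha) (setOf_exists_eq_subset.2 hφδ)) (empty_disjoint S)
    · exact fun m φ hφ hφS => hS.mem_of_normal (.static_e m φ t p hφ ht hp)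
        (setOf_exists_eq_subset.2 hφS) (empty_disjoint S)

theorem possiblyHolds_eff_iff (hD : WellFormed D) (hS : IsAnswerSet (encoding h w D I G) S)
    (ha : occ a t p ∈ S) {φ : Set (Lit F)} :
    PossiblyHolds φ (eff D a (stateAt S t p)) ↔ ∀ m ∈ φ, e m.compl t p ∉ S := by
  simp only [possiblyHolds_iff, e_mem_iff hD hS, exists_occ_and_iff hS ha]

theorem pc_mem_iff (hD : WellFormed D) (hS : IsAnswerSet (encoding h w D I G) S) :
    pc l t p ∈ S ↔ ∃ a, occ a t p ∈ S ∧ l ∈ possibleChanges D a (stateAt S t p) := by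
  constructor
  · refine hS.induction (pc · t p)
      (M := fun l => ∃ a, occ a t p ∈ S ∧ l ∈ possibleChanges D a (stateAt S t p))
      fun r hr hneg hpos ih l hl => ?_
    cases hr with
    | causes_pc a l φ t p hφ =>
      obtain ⟨⟩ := hl
      obtain ⟨hlδ, hφδ⟩ := disjoint_union_left.1 hneg
      rw [disjoint_singleton_left] at hlδ
      rw [disjoint_setOf_exists_eq] at hφδ
      exact ⟨a, singleton_subset_iff.1 hpos,
        mem_possibleChanges_of_causes hφ hlδ (possiblyHolds_iff.2 hφδ)⟩
    | static_pc l φ m t p hφ hm =>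
      obtain ⟨⟩ := hl
      obtain ⟨hlδ, hφe⟩ := disjoint_union_left.1 hneg
      rw [disjoint_singleton_left] at hlδ
      rw [disjoint_setOf_exists_eq] at hφe
      obtain ⟨a, ha, hmpc⟩ := ih m rfl
      exact ⟨a, ha, mem_possibleChanges_of_staticLaw hφ hlδ hm hmpc
        ((possiblyHolds_eff_iff hD hS ha).2 hφe)⟩
    | _ => simp at hl
  · rintro ⟨a, ha, hl⟩
    obtain ⟨ht, hp, -, -⟩ := occ_mem_imp hS ha
    refine possibleChanges_subset (X := {l | pc l t p ∈ S}) ?_ ?_ hl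
    · exact fun l φ hφ hlδ hposs => hS.mem_of_normal (.causes_pc a l φ t p hφ ht hp)
        (singleton_subset_iff.2 ha) (disjoint_union_left.2 ⟨disjoint_singleton_left.2 hlδ,
          disjoint_setOf_exists_eq.2 (possiblyHolds_iff.1 hposs)⟩)
    · exact fun l φ hφ hlδ hposs m hm hmpc =>
        hS.mem_of_normal (.static_pc l φ m t p hφ hm ht hp) (singleton_subset_iff.2 hmpc)
          (disjoint_union_left.2 ⟨disjoint_singleton_left.2 hlδ,
            disjoint_setOf_exists_eq.2 ((possiblyHolds_eff_iff hD hS ha).1 hposs)⟩)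

theorem used_of_holds_mem (hD : WellFormed D) (hS : IsAnswerSet (encoding h w D I G) S)
    (hl : holds l t p ∈ S) : used t p ∈ S := by
  refine hS.induction (fun x : Lit F × ℕ × ℕ => holds x.1 x.2.1 x.2.2)
    (M := fun x => used x.2.1 x.2.2 ∈ S) (i := (l, t, p)) ?_ hl
  rintro r hr - hpos ih ⟨l, t, p⟩ hl
  cases hr with
  | init l hl =>
    obtain ⟨⟩ := hl
    exact used_one_one_mem hS
  | static_holds l φ t p hφ =>
    obtain ⟨⟩ := hl
    obtain ⟨m, hm⟩ := hD.static_nonempty l φ hφ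
    exact ih (m, t, p) ⟨m, hm, rfl⟩
  | effect l t p ht hp =>
    obtain ⟨⟩ := hl
    obtain ⟨a, ha, -⟩ := (e_mem_iff hD hS).1 (singleton_subset_iff.1 hpos)
    exact used_succ_of_used hS ht hp (occ_mem_imp hS ha).2.2.1
  | inertia l l₁ t p ht hp =>
    obtain ⟨⟩ := hl
    exact used_succ_of_used hS ht hp (ih (l, t, p) (Or.inl rfl))
  | br_holds g t p p₁ =>
    obtain ⟨⟩ := hl
    exact used_succ_of_br_mem hS (singleton_subset_iff.1 hpos)
  | br_copy g l t p p₁ =>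
    obtain ⟨⟩ := hl
    exact used_succ_of_br_mem hS (hpos (Or.inl rfl))
  | _ => simp at hl

/-- `Introduced S I t p l`: given `S`, some rule other than a static causal law puts `l` into row
`t` of column `p`. Rows are numbered from `1`, whence the conditions `1 ≤ t`. -/
inductive Introduced (S : Set (Atom F A)) (I : Set (Lit F)) : ℕ → ℕ → Lit F → Prop
  | init {l : Lit F} : l ∈ I → Introduced S I 1 1 l
  | effect {l : Lit F} {t p : ℕ} : 1 ≤ t → e l t p ∈ S → Introduced S I (t + 1) p l
  | inertia {l : Lit F} {t p : ℕ} : 1 ≤ t → holds l t p ∈ S → pc l.compl t p ∉ S →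
      Introduced S I (t + 1) p l
  | sensed {l : Lit F} {t p p₁ : ℕ} : 1 ≤ t → br l t p₁ p ∈ S → Introduced S I (t + 1) p l
  | copied {g l : Lit F} {t p p₁ : ℕ} : 1 ≤ t → p₁ < p → br g t p₁ p ∈ S → holds l t p₁ ∈ S →
      Introduced S I (t + 1) p l

theorem stateAt_subset_cl (hS : IsAnswerSet (encoding h w D I G) S) :
    stateAt S t p ⊆ Cl D {l | Introduced S I t p l} := by
  intro l
  refine hS.induction (holds · t p) fun r hr hneg hpos ih l hl => ?_
  cases hr with
  | init l hlI =>
    obtain ⟨⟩ := hl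
    exact subset_cl (.init hlI)
  | static_holds l φ t p hφ =>
    obtain ⟨⟩ := hl
    exact satisfiesStatic_cl l φ hφ fun m hm => ih m ⟨m, hm, rfl⟩
  | effect l t p ht =>
    obtain ⟨⟩ := hl
    exact subset_cl (.effect ht.1 (singleton_subset_iff.1 hpos))
  | inertia l l₁ t p ht =>
    obtain ⟨⟩ := hl
    obtain rfl := (contrary_mem_iff hS).1 (hpos (Or.inr rfl))
    exact subset_cl (.inertia ht.1 (hpos (Or.inl rfl)) (disjoint_singleton_left.1 hneg))
  | br_holds g t p p₁ _ ht =>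
    obtain ⟨⟩ := hl
    exact subset_cl (.sensed ht.1 (singleton_subset_iff.1 hpos))
  | br_copy g l t p p₁ _ ht _ _ hlt =>
    obtain ⟨⟩ := hl
    exact subset_cl (.copied ht.1 hlt (hpos (Or.inl rfl)) (hpos (Or.inr rfl)))
  | _ => simp at hl

theorem holds_mem_of_introduced (hS : IsAnswerSet (encoding h w D I G) S) (ht : t ≤ h + 1)
    (hp : p ∈ Icc 1 w) (hl : Introduced S I t p l) : holds l t p ∈ S := by
  cases hl with
  | init hl => exact hS.mem_of_fact (.init l hl)
  | @effect _ t _ ht₁ hl =>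
    exact hS.mem_of_normal (.effect l t p ⟨ht₁, by omega⟩ hp) (singleton_subset_iff.2 hl)
      (empty_disjoint S)
  | @inertia _ t _ ht₁ hl hpc =>
    exact hS.mem_of_normal (.inertia l l.compl t p ⟨ht₁, by omega⟩ hp)
      (pair_subset hl ((contrary_mem_iff hS).2 rfl)) (disjoint_singleton_left.2 hpc)
  | @sensed _ t _ p₁ ht₁ hl =>
    obtain ⟨ht, hp₁, -⟩ := source_mem_of_br_mem hS hl
    exact hS.mem_of_normal (.br_holds l t p p₁ (sensedLit_of_br_mem hS hl) ht hp hp₁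
      (br_mem_imp hS hl).2.1) (singleton_subset_iff.2 hl) (empty_disjoint S)
  | @copied g _ t _ p₁ ht₁ hlt hg hl =>
    obtain ⟨ht, hp₁, -⟩ := source_mem_of_br_mem hS hg
    exact hS.mem_of_normal (.br_copy g l t p p₁ (sensedLit_of_br_mem hS hg) ht hp hp₁ hlt)
      (pair_subset hg hl) (empty_disjoint S)

theorem stateAt_eq_cl (hS : IsAnswerSet (encoding h w D I G) S) (ht : t ∈ Icc 1 (h + 1))
    (hp : p ∈ Icc 1 w) : stateAt S t p = Cl D {l | Introduced S I t p l} := by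
  refine (stateAt_subset_cl hS).antisymm (cl_subset ?_ fun l φ hφ hφS => ?_)
  · exact fun l hl => holds_mem_of_introduced hS ht.2 hp hl
  · exact hS.mem_of_normal (.static_holds l φ t p hφ ht hp) (setOf_exists_eq_subset.2 hφS)
      (empty_disjoint S)

theorem stateAt_one_one (hS : IsAnswerSet (encoding h w D I G) S) (hw : 1 ≤ w) :
    stateAt S 1 1 = initialAState D I := by
  rw [stateAt_eq_cl hS (by simp) ⟨le_rfl, hw⟩, initialAState]
  congr 1
  ext l
  refine ⟨fun hl => ?_, .init⟩
  cases hl with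
  | init hl => exact hl
  | _ => omega

theorem stateAt_succ_of_nonSensing (hD : WellFormed D)
    (hS : IsAnswerSet (encoding h w D I G) S) (ha : occ a t p ∈ S) (hns : ¬ Sensing D a) :
    stateAt S (t + 1) p = successor D a (stateAt S t p) := by
  obtain ⟨ht, hp, -, -⟩ := occ_mem_imp hS ha
  rw [stateAt_eq_cl hS ⟨by omega, Nat.succ_le_succ ht.2⟩ hp, successor]
  congr 1
  ext l
  have he : e l t p ∈ S ↔ l ∈ eff D a (stateAt S t p) :=
    (e_mem_iff hD hS).trans (exists_occ_and_iff hS ha)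
  have hpc : pc l.compl t p ∈ S ↔ l.compl ∈ possibleChanges D a (stateAt S t p) :=
    (pc_mem_iff hD hS).trans (exists_occ_and_iff hS ha)
  rw [mem_union, mem_sdiff, Lit.mem_image_compl, ← he, ← hpc]
  constructor
  · intro hl
    cases hl with
    | init => exact absurd ht.1 (by omega)
    | effect _ hl => exact Or.inl hl
    | inertia _ hl hpc => exact Or.inr ⟨hl, hpc⟩
    | sensed _ hl => exact (hns (sensing_of_occ_of_br hS ha hl)).elim
    | copied _ _ hg _ => exact (hns (sensing_of_occ_of_br hS ha hg)).elim
  · rintro (hl | ⟨hl, hpc⟩)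
    · exact .effect ht.1 hl
    · exact .inertia ht.1 hl hpc

theorem stateAt_succ_of_br_mem (hD : WellFormed D) (hS : IsAnswerSet (encoding h w D I G) S)
    (hg : br g t p q ∈ S) : stateAt S (t + 1) q = Cl D (stateAt S t p ∪ {g}) := by
  obtain ⟨hq, hpq, -⟩ := br_mem_imp hS hg
  obtain ⟨ht, -, -⟩ := source_mem_of_br_mem hS hg
  have he (l : Lit F) : e l t q ∉ S := fun hl => by
    obtain ⟨a, ha, hl⟩ := (e_mem_iff hD hS).1 hl
    simp [hD.eff_eq_empty (sensing_of_occ_of_br hS ha hg)] at hl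
  have hpc (l : Lit F) : pc l t q ∉ S := fun hl => by
    obtain ⟨a, ha, hl⟩ := (pc_mem_iff hD hS).1 hl
    simp [hD.possibleChanges_eq_empty (sensing_of_occ_of_br hS ha hg)] at hl
  rw [stateAt_eq_cl hS ⟨by omega, Nat.succ_le_succ ht.2⟩ hq]
  congr 1
  ext l
  constructor
  · intro hl
    cases hl with
    | init => exact absurd ht.1 (by omega)
    | effect _ hl => exact (he l hl).elim
    | inertia _ hl _ =>
      obtain rfl := source_eq_of_used hS hg (used_of_holds_mem hD hS hl)
      exact Or.inl hl
    | sensed _ hl =>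
      obtain rfl := br_source_unique hS hg hl
      exact Or.inr (br_label_unique hS hl hg)
    | copied _ _ hg' hl =>
      obtain rfl := br_source_unique hS hg hg'
      exact Or.inl hl
  · rintro (hl | rfl)
    · rcases hpq.eq_or_lt with rfl | hlt
      · exact .inertia ht.1 hl (hpc _)
      · exact .copied ht.1 hlt hg hl
    · exact .sensed ht.1 hg

theorem goal_mem_of_forall_occ_notMem (hS : IsAnswerSet (encoding h w D I G) S)
    (ht : t ∈ Icc 1 (h + 1)) (hp : p ∈ Icc 1 w) (hu : used t p ∈ S)
    (hfinished : t = h + 1 ∨ ∀ a, occ a t p ∉ S) : goal t p ∈ S := by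
  rcases ht.2.eq_or_lt with rfl | hlt
  · exact goal_last_mem hS hp hu
  · by_contra hg
    obtain ⟨a, ha, -⟩ := existsUnique_occ hS ⟨ht.1, Nat.le_of_lt_succ hlt⟩ hp hu hg
    exact hfinished.elim hlt.ne fun hocc => hocc a ha

section Extraction

variable {i k : ℕ} {P P' : Plan F A}

theorem ExtractedPlan.isConditionalPlan (hP : ExtractedPlan D h S i k P) :
    IsConditionalPlan D P := by
  induction hP with
  | finished => trivial
  | nonSensing _ _ _ _ _ _ hns _ ih => exact ⟨hns, ih⟩
  | sensing _ _ _ _ _ _ _ _ hθ _ _ ih => exact ⟨hθ, ih⟩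

theorem exists_extractedPlan (hS : IsAnswerSet (encoding h w D I G) S) (hi : i ≤ h + 1) :
    ∃ P, ExtractedPlan D h S i k P := by
  induction hi using Nat.decreasingInduction generalizing k with
  | self => exact ⟨.empty, .finished _ _ (Or.inl rfl)⟩
  | of_succ i hi ih =>
    by_cases hocc : ∃ a, occ a i k ∈ S
    · obtain ⟨a, ha⟩ := hocc
      by_cases hs : Sensing D a
      · obtain ⟨θ, hθ⟩ := hs
        choose c hc _ using fun g : θ => existsUnique_br hS hθ g.2 ha
        choose P hP using fun g : θ => ih (k := c g)
        exact ⟨.cases a θ P, .sensing i k a θ c P (Nat.le_of_lt_succ hi) ha hθ hc hP⟩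
      · obtain ⟨P, hP⟩ := ih (k := k)
        exact ⟨.seq a P, .nonSensing i k a P (Nat.le_of_lt_succ hi) ha hs hP⟩
    · exact ⟨.empty, .finished i k (Or.inr (not_exists.1 hocc))⟩

theorem not_finished_of_occ_mem (hS : IsAnswerSet (encoding h w D I G) S) (ha : occ a t p ∈ S) :
    ¬ (t = h + 1 ∨ ∀ b, occ b t p ∉ S) := by
  rintro (rfl | hocc)
  · exact Nat.not_succ_le_self h (occ_mem_imp hS ha).1.2
  · exact hocc a ha

theorem ExtractedPlan.unique (hD : WellFormed D) (hS : IsAnswerSet (encoding h w D I G) S)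
    (hP : ExtractedPlan D h S i k P) (hP' : ExtractedPlan D h S i k P') : P = P' := by
  induction hP generalizing P' with
  | finished i k hfinished =>
    cases hP' with
    | finished => rfl
    | nonSensing _ _ _ _ _ ha => exact (not_finished_of_occ_mem hS ha hfinished).elim
    | sensing _ _ _ _ _ _ _ ha => exact (not_finished_of_occ_mem hS ha hfinished).elim
  | nonSensing i k a P _ ha hns _ ih =>
    cases hP' with
    | finished _ _ hfinished => exact (not_finished_of_occ_mem hS ha hfinished).elim
    | nonSensing _ _ _ _ _ hb _ hP' => rw [occ_unique hS ha hb, ih hP']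
    | sensing _ _ _ θ _ _ _ hb hθ =>
      obtain rfl := occ_unique hS ha hb
      exact (hns ⟨θ, hθ⟩).elim
  | sensing i k a θ c P _ ha hθ hc _ ih =>
    cases hP' with
    | finished _ _ hfinished => exact (not_finished_of_occ_mem hS ha hfinished).elim
    | nonSensing _ _ _ _ _ hb hns =>
      obtain rfl := occ_unique hS ha hb
      exact (hns ⟨θ, hθ⟩).elim
    | sensing _ _ _ θ' c' _ _ hb hθ' hc' hP' =>
      obtain rfl := occ_unique hS ha hb
      obtain rfl := hD.determines_unique a θ θ' hθ hθ'
      obtain rfl : c = c' := funext fun g => (existsUnique_br hS hθ g.2 ha).unique (hc g) (hc' g)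
      rw [funext fun g => ih g (hP' g)]

theorem ExtractedPlan.knowsAfter (hD : WellFormed D) (hS : IsAnswerSet (encoding h w D I G) S)
    (hP : ExtractedPlan D h S i k P) (hi : i ∈ Icc 1 (h + 1)) (hk : k ∈ Icc 1 w)
    (hu : used i k ∈ S) (hc : Consistent (stateAt S i k)) :
    KnowsAfter D G P (stateAt S i k) := by
  induction hP with
  | finished i k hfinished =>
    have hgoal : goal i k ∈ S := goal_mem_of_forall_occ_notMem hS hi hk hu hfinished
    exact knowsAfter_empty (subset_stateAt_of_goal_mem hS hgoal hc)
  | nonSensing i k a P hih ha hns _ ih =>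
    refine knowsAfter_seq (executable_of_occ_mem hS ha) hns ?_
    rw [← stateAt_succ_of_nonSensing hD hS ha hns]
    exact ih ⟨by omega, by omega⟩ hk (used_succ_of_used hS ⟨hi.1, hih⟩ hk hu)
  | sensing i k a θ c P hih ha hθ hc' _ ih =>
    refine hD.knowsAfter_cases hθ (executable_of_occ_mem hS ha) fun g => ?_
    rw [← stateAt_succ_of_br_mem hD hS (hc' g)]
    exact ih g ⟨by omega, by omega⟩ (br_mem_imp hS (hc' g)).1 (used_succ_of_br_mem hS (hc' g))

end Extraction

end Encoding

end ASCP

theorem theorem3p1_general {F A : Type*} {D : ASCP.Domain F A} {I G : Set (ASCP.Lit F)}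
    (hD : ASCP.WellFormed D) (hI : ASCP.Consistent (ASCP.initialAState D I)) {h w : ℕ}
    (hw : 1 ≤ w) {S : Set (ASCP.Atom F A)}
    (hS : ASCP.IsAnswerSet (ASCP.encoding h w D I G) S) :
    ∃ p : ASCP.Plan F A, ASCP.ExtractedPlan D h S 1 1 p ∧
      (∀ q, ASCP.ExtractedPlan D h S 1 1 q → q = p) ∧
      ASCP.IsSolution D I G p := by
  obtain ⟨p, hp⟩ := ASCP.exists_extractedPlan hS (i := 1) (k := 1) (by omega)
  have hstate : ASCP.stateAt S 1 1 = ASCP.initialAState D I := ASCP.stateAt_one_one hS hw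
  have hknows : ASCP.KnowsAfter D G p (ASCP.initialAState D I) := by
    rw [← hstate] at hI ⊢
    exact hp.knowsAfter hD hS (by simp) ⟨le_rfl, hw⟩ (ASCP.used_one_one_mem hS) hI
  exact ⟨p, hp, fun q hq => hq.unique hD hS hp, hp.isConditionalPlan, hknows⟩

/-- Soundness of the encoding: the extraction procedure, applied to an answer set, returns exactly
one plan, and this plan is a solution. -/
theorem theorem3p1 {F A : Type*} (D : ASCP.Domain F A) (I G : Set (ASCP.Lit F))
    (hD : ASCP.WellFormed D) (hG : G.Nonempty) (hcons : ASCP.ConsistentTheory D I)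
    (h w : ℕ) (hh : 1 ≤ h) (hw : 1 ≤ w) (S : Set (ASCP.Atom F A))
    (hS : ASCP.IsAnswerSet (ASCP.encoding h w D I G) S) :
    ∃ p : ASCP.Plan F A, ASCP.ExtractedPlan D h S 1 1 p ∧
      (∀ q, ASCP.ExtractedPlan D h S 1 1 q → q = p) ∧
      ASCP.IsSolution D I G p := by
  exact theorem3p1_general hD hcons.2.1.1 hw hS
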